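/- **Theorem (strong normalization of $\mathsf{AF2}^{M\mu\nu}$).** If the judgment $\Gamma\vdash_{\mathbb E} t:A$ is derivable in the logic $\mathsf{AF2}^{M\mu\nu}$ defined below, then the proof-term $t$ is strongly normalizing: there is no infinite reduction sequence $t\to_\beta t_1\to_\beta t_2\to_\beta\cdots$. *Language.* Fix a second-order signature of function symbols and predicate symbols of all arities. Object terms are $t::=x\mid f(t_1,\dots,t_n)$. For unary function symbols $f,g$ the composition $f\circ g$ is regarded as a further unary function symbol, with defining equation $(f\circ g)(x)=f(g(x))$. Predicates and formulas are $$\mathcal P::=X\mid P\mid\lambda\vec x.A\mid\mu(\Phi)\mid\nu(\Phi),\qquad A,B::=\mathcal P(t_1,\dots,t_n)\mid A\to B\mid\forall x\,A\mid\forall X\,A,$$ where $X$ is a second-order variable of some arity, $P$ a predicate symbol, and $\Phi=\lambda X.\mathcal P$ is a closed predicate transformer ($X$ and $\mathcal P$ have the same arity $n$, which is the arity of $\mu(\Phi)$ and $\nu(\Phi)$; there is no positivity condition on $X$). A comprehension $\lambda\vec x.A$ represents $\{\vec t\mid A[\vec x:=\vec t\,]\}$: formulas are identified along the congruence (through $\to$,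 $\forall x$, $\forall X$) generated by $(\lambda\vec x.A)(\vec t\,)=A[\vec x:=\vec t\,]$. Write $\Phi(\mathcal R)=\mathcal P[X:=\mathcal R]$. To each $\mu(\Phi)$ of arity $n$ is assigned a fixed vector $\vec c$ of $n$ unary function symbols (constructors), and to each $\nu(\Phi)$ a fixed vector $\vec d$ (destructors). For vectors of unary function symbols, $\vec f(\vec t\,)=f_1(t_1),\dots,f_n(t_n)$ and $\vec f\circ\vec c=f_1\circ c_1,\dots,f_n\circ c_n$; $\;\mathcal P\subseteq_{\vec g}\mathcal R$ is the formula $\forall\vec x.\,\mathcal P(\vec x)\to\mathcal R(\vec g(\vec x))$, and $\mathcal P\subseteq\mathcal R$ is $\forall\vec x.\,\mathcal P(\vec x)\to\mathcal R(\vec x)$. *Proof-terms and reduction.* Proof-terms are $r,s,t::=x\mid\lambda x\,r\mid r\,s\mid\mathsf{in}\,r\mid\mathsf{out}\,r\mid\mathsf{MRec}\,s\,r\mid\mathsf{MCoRec}\,s\,r$. The relation $\to_\beta$ is the closure under all term formers of $$(\lambda x\,r)s\mapsto r[x:=s],\qquad \mathsf{MRec}\,s\,(\mathsf{in}\,t)\mapsto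 s(\lambda x\,x)(\mathsf{MRec}\,s)\,t,\qquad \mathsf{out}(\mathsf{MCoRec}\,s\,t)\mapsto s(\lambda x\,x)(\mathsf{MCoRec}\,s)\,t,$$ where $\mathsf{MRec}\,s$ abbreviates $\lambda x.\mathsf{MRec}\,s\,x$ and $\mathsf{MCoRec}\,s$ abbreviates $\lambda x.\mathsf{MCoRec}\,s\,x$, with $x$ not free in $s$. *Equations.* $\mathbb E$ is a set of equations between object terms. $\mathbb E\rhd r=s$ means that $r=s$ is derivable by reflexivity, transitivity and compatibility with function symbols from substitution instances, read in either direction, of equations in $\mathbb E$ and of the defining equations of compositions. *Derivations.* $\Gamma$ is a context $x_1:A_1,\dots,x_n:A_n$. The judgment $\Gamma\vdash_{\mathbb E}t:A$ is defined inductively by the following rules ($\mathbb E$ is omitted where it plays no role). - $\Gamma,x:A\vdash x:A$. If $\Gamma,x:A\vdash r:B$ then $\Gamma\vdash\lambda x\,r:A\to B$. If $\Gamma\vdash r:A\to B$ and $\Gamma\vdash s:A$ then $\Gamma\vdash r\,s:B$. - If $\Gamma\vdash t:A$ and $x\notin FV(\Gamma)$ then $\Gamma\vdash t:\forall x\,A$.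 If $\Gamma\vdash t:\forall x\,A$ then $\Gamma\vdash t:A[x:=r]$ for every object term $r$. - If $\Gamma\vdash t:A$ and $X\notin FV(\Gamma)$ then $\Gamma\vdash t:\forall X\,A$. If $\Gamma\vdash t:\forall X\,A$ then $\Gamma\vdash t:A[X:=\mathcal P]$ for every predicate $\mathcal P$ of the arity of $X$. - If $\Gamma\vdash_{\mathbb E}t:A[x:=r]$ and $\mathbb E\rhd r=s$ then $\Gamma\vdash_{\mathbb E}t:A[x:=s]$. - $(\mu I)$ If $\Gamma\vdash r:\Phi(\mu(\Phi))(\vec t\,)$ then $\Gamma\vdash\mathsf{in}\,r:\mu(\Phi)(\vec c(\vec t\,))$. - $(\mu E)$ If $\Gamma\vdash s:\forall X\big(X\subseteq\mu(\Phi)\to X\subseteq_{\vec f}\mathcal K\to\Phi(X)\subseteq_{\vec f\circ\vec c}\mathcal K\big)$ and $\Gamma\vdash r:\mu(\Phi)(\vec t\,)$ then $\Gamma\vdash\mathsf{MRec}\,s\,r:\mathcal K(\vec f(\vec t\,))$. - $(\nu E)$ If $\Gamma\vdash r:\nu(\Phi)(\vec t\,)$ then $\Gamma\vdash\mathsf{out}\,r:\Phi(\nu(\Phi))(\vec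 d(\vec t\,))$. - $(\nu I)$ If $\Gamma\vdash s:\forall X\big(\nu(\Phi)\subseteq X\to\mathcal K\subseteq_{\vec f}X\to\mathcal K\subseteq_{\vec d\circ\vec f}\Phi(X)\big)$ and $\Gamma\vdash r:\mathcal K(\vec t\,)$ then $\Gamma\vdash\mathsf{MCoRec}\,s\,r:\nu(\Phi)(\vec f(\vec t\,))$. In $(\mu E)$ and $(\nu I)$, $\mathcal K$ is any predicate of the arity of $\Phi$ in which $X$ is not free, and $\vec f$ is any vector of unary function symbols. -/

import Mathlib

namespace AF2

/-! ## Object terms -/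

/-- A second-order signature: function symbols and predicate symbols of every arity. -/
structure Signature where
  Func : ℕ → Type
  Rel : ℕ → Type

/-- Function symbols. A composition of two unary function symbols is regarded as a new unary
function symbol; its defining equation is in `compEqs` below. -/
inductive Fn (S : Signature) : ℕ → Type
  | base {n : ℕ} : S.Func n → Fn S n
  | comp : Fn S 1 → Fn S 1 → Fn S 1

/-- Object terms with variables in `V`: `t ::= x | f(t₁,…,tₙ)`. -/
inductive Term (S : Signature) (V : Type) : Type
  | var : V → Term S V
  | app {n : ℕ} : Fn S n → (Fin n → Term S V) → Term S V

namespace Term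

variable {S : Signature} {V V' : Type}

/-- Simultaneous substitution of terms for variables. -/
def sub (σ : V → Term S V') : Term S V → Term S V'
  | var v => σ v
  | app f ts => app f fun i => (ts i).sub σ

/-- Renaming of variables. -/
def ren (ρ : V → V') (t : Term S V) : Term S V' :=
  t.sub fun v => var (ρ v)

/-- `f(t)` for a unary function symbol. -/
def app1 (f : Fn S 1) (t : Term S V) : Term S V :=
  app f fun _ => t

/-- `f⃗(t⃗) = f₁(t₁),…,fₙ(tₙ)` for a vector of `n` unary function symbols. -/
def appVec {n : ℕ} (f : Fin n → Fn S 1) (t : Fin n → Term S V) : Fin n → Term S V :=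
  fun i => app1 (f i) (t i)

end Term

/-! ## Predicates and formulas

Binding is expressed by types: `V` is the type of first-order variables in scope and `W n` is the
type of `n`-ary second-order variables in scope. -/

/-- Second-order variables after adding one new variable of arity `m`. -/
inductive SVar (W : ℕ → Type) (m : ℕ) : ℕ → Type
  | new : SVar W m m
  | old {n : ℕ} : W n → SVar W m n

/-- No second-order variables. -/
abbrev NoSVar : ℕ → Type := fun _ => Empty

mutual
  /-- `n`-ary predicates `𝒫 ::= X | P | λx⃗.A | μ(Φ) | ν(Φ)`. The argument of `mu` and `nu` is the
  body `𝒫` of a closed predicate transformer `Φ = λX.𝒫`: its only free variable is `X`, without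
  any restriction on the occurrences of `X`. -/
  inductive Pred (S : Signature) : (V : Type) → (W : ℕ → Type) → ℕ → Type 1
    | pvar {V : Type} {W : ℕ → Type} {n : ℕ} : W n → Pred S V W n
    | rel {V : Type} {W : ℕ → Type} {n : ℕ} : S.Rel n → Pred S V W n
    | compr {V : Type} {W : ℕ → Type} {n : ℕ} : Formula S (V ⊕ Fin n) W → Pred S V W n
    | mu {V : Type} {W : ℕ → Type} {n : ℕ} : Pred S Empty (SVar NoSVar n) n → Pred S V W n
    | nu {V : Type} {W : ℕ → Type} {n : ℕ} : Pred S Empty (SVar NoSVar n) n → Pred S V W n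

  /-- Formulas `A, B ::= 𝒫(t₁,…,tₙ) | A → B | ∀x A | ∀X A`. -/
  inductive Formula (S : Signature) : (V : Type) → (W : ℕ → Type) → Type 1
    | app {V : Type} {W : ℕ → Type} {n : ℕ} :
        Pred S V W n → (Fin n → Term S V) → Formula S V W
    | imp {V : Type} {W : ℕ → Type} : Formula S V W → Formula S V W → Formula S V W
    | all1 {V : Type} {W : ℕ → Type} : Formula S (Option V) W → Formula S V W
    | all2 {V : Type} {W : ℕ → Type} (m : ℕ) : Formula S V (SVar W m) → Formula S V W
end

/-- Closed predicate transformers `Φ = λX.𝒫` of arity `n`, given by their body. -/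
abbrev Transformer (S : Signature) (n : ℕ) : Type 1 := Pred S Empty (SVar NoSVar n) n

/-! ### Renaming -/

/-- Extension of a renaming of second-order variables under a second-order binder. -/
def SVar.lift {W W' : ℕ → Type} {m : ℕ} (θ : ∀ n, W n → W' n) :
    ∀ n, SVar W m n → SVar W' m n
  | _, .new => .new
  | n, .old X => .old (θ n X)

mutual
  /-- Renaming of the free variables of a predicate. -/
  def Pred.ren {S : Signature} : {V : Type} → {W : ℕ → Type} → {n : ℕ} → Pred S V W n →
      {V' : Type} → {W' : ℕ → Type} → (V → V') → (∀ k, W k → W' k) → Pred S V' W' n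
    | _, _, _, .pvar X, _, _, _, θ => .pvar (θ _ X)
    | _, _, _, .rel P, _, _, _, _ => .rel P
    | _, _, _, .compr A, _, _, ρ, θ => .compr (A.ren (Sum.map ρ id) θ)
    | _, _, _, .mu Φ, _, _, _, _ => .mu Φ
    | _, _, _, .nu Φ, _, _, _, _ => .nu Φ

  /-- Renaming of the free variables of a formula. -/
  def Formula.ren {S : Signature} : {V : Type} → {W : ℕ → Type} → Formula S V W →
      {V' : Type} → {W' : ℕ → Type} → (V → V') → (∀ k, W k → W' k) → Formula S V' W'
    | _, _, .app P ts, _, _, ρ, θ => .app (P.ren ρ θ) fun i => (ts i).ren ρ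
    | _, _, .imp A B, _, _, ρ, θ => .imp (A.ren ρ θ) (B.ren ρ θ)
    | _, _, .all1 A, _, _, ρ, θ => .all1 (A.ren (Option.map ρ) θ)
    | _, _, .all2 m A, _, _, ρ, θ => .all2 m (A.ren ρ (SVar.lift θ))
end

/-! ### Capture-avoiding substitution -/

section Lifting

variable {S : Signature} {V V' : Type} {W W' : ℕ → Type}

/-- A first-order substitution under a first-order quantifier. -/
def liftOption (σ : V → Term S V') : Option V → Term S (Option V')
  | none => .var none
  | some v => (σ v).ren some

/-- A first-order substitution under a comprehension binder. -/
def liftSum {n : ℕ} (σ : V → Term S V') : V ⊕ Fin n → Term S (V' ⊕ Fin n)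
  | .inl v => (σ v).ren Sum.inl
  | .inr i => .var (.inr i)

/-- A second-order substitution under a second-order quantifier. -/
def liftSVar {m : ℕ} (τ : ∀ k, W k → Pred S V' W' k) :
    ∀ k, SVar W m k → Pred S V' (SVar W' m) k
  | _, .new => .pvar .new
  | k, .old X => (τ k X).ren id fun _ => SVar.old

end Lifting

mutual
  /-- Simultaneous capture-avoiding substitution of terms for first-order variables and of
  predicates for second-order variables, in a predicate. -/
  def Pred.sub {S : Signature} : {V : Type} → {W : ℕ → Type} → {n : ℕ} → Pred S V W n →
      {V' : Type} → {W' : ℕ → Type} → (V → Term S V') → (∀ k, W k → Pred S V' W' k) →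
      Pred S V' W' n
    | _, _, _, .pvar X, _, _, _, τ => τ _ X
    | _, _, _, .rel P, _, _, _, _ => .rel P
    | _, _, _, .compr A, _, _, σ, τ =>
        .compr (A.sub (liftSum σ) fun k X => (τ k X).ren Sum.inl fun _ => id)
    | _, _, _, .mu Φ, _, _, _, _ => .mu Φ
    | _, _, _, .nu Φ, _, _, _, _ => .nu Φ

  /-- Simultaneous capture-avoiding substitution in a formula. -/
  def Formula.sub {S : Signature} : {V : Type} → {W : ℕ → Type} → Formula S V W →
      {V' : Type} → {W' : ℕ → Type} → (V → Term S V') → (∀ k, W k → Pred S V' W' k) →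
      Formula S V' W'
    | _, _, .app P ts, _, _, σ, τ => .app (P.sub σ τ) fun i => (ts i).sub σ
    | _, _, .imp A B, _, _, σ, τ => .imp (A.sub σ τ) (B.sub σ τ)
    | _, _, .all1 A, _, _, σ, τ =>
        .all1 (A.sub (liftOption σ) fun k X => (τ k X).ren some fun _ => id)
    | _, _, .all2 m A, _, _, σ, τ =>
        .all2 m (A.sub σ (liftSVar τ))
end

section Operations

variable {S : Signature} {V : Type} {W : ℕ → Type}

/-- `A` seen under a new first-order variable that does not occur in it. -/
def Formula.weaken1 (A : Formula S V W) : Formula S (Option V) W := A.ren some fun _ => id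

/-- `A` seen under a new `m`-ary second-order variable that does not occur in it. -/
def Formula.weaken2 (m : ℕ) (A : Formula S V W) : Formula S V (SVar W m) :=
  A.ren id fun _ => SVar.old

/-- `A[x := r]`, where `x` is the variable bound by a first-order quantifier over `A`. -/
def Formula.inst1 (A : Formula S (Option V) W) (r : Term S V) : Formula S V W :=
  A.sub (fun o => o.elim r Term.var) fun _ => Pred.pvar

/-- The substitution `X := 𝒫`. -/
def instSVar {m : ℕ} (P : Pred S V W m) : ∀ k, SVar W m k → Pred S V W k
  | _, .new => P
  | _, .old X => .pvar X

/-- `A[X := 𝒫]`, where `X` is the variable bound by a second-order quantifier over `A`. -/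
def Formula.inst2 {m : ℕ} (A : Formula S V (SVar W m)) (P : Pred S V W m) : Formula S V W :=
  A.sub Term.var (instSVar P)

/-- `A[x⃗ := t⃗]`, where `x⃗` are the variables bound by a comprehension `λx⃗.A`. -/
def Formula.instVec {n : ℕ} (A : Formula S (V ⊕ Fin n) W) (t : Fin n → Term S V) :
    Formula S V W :=
  A.sub (Sum.elim Term.var t) fun _ => Pred.pvar

/-- The substitution of `ℛ` for the only free variable of a transformer's body. -/
def applySVar {n : ℕ} (R : Pred S V W n) : ∀ k, SVar NoSVar n k → Pred S V W k
  | _, .new => R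
  | _, .old X => X.elim

/-- `Φ(ℛ) = 𝒫[X := ℛ]` for `Φ = λX.𝒫`. -/
def Transformer.apply {n : ℕ} (Φ : Transformer S n) (R : Pred S V W n) : Pred S V W n :=
  Pred.sub Φ (fun v : Empty => v.elim) (applySVar R)

/-- `∀x₁…∀xₙ A`. -/
def allVec : (n : ℕ) → Formula S (V ⊕ Fin n) W → Formula S V W
  | 0, A => A.ren (Sum.elim id fun i => i.elim0) fun _ => id
  | n + 1, A =>
      allVec n (.all1 (A.ren
        (Sum.elim (fun v => some (Sum.inl v))
          (Fin.lastCases (motive := fun _ => Option (V ⊕ Fin n)) none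
            fun i => some (Sum.inr i)))
        fun _ => id))

/-- `𝒫 ⊆_g⃗ ℛ`, the formula `∀x⃗. 𝒫(x⃗) → ℛ(g⃗(x⃗))`. -/
def inclVia {n : ℕ} (g : Fin n → Fn S 1) (P R : Pred S V W n) : Formula S V W :=
  allVec n (.imp
    (.app (P.ren Sum.inl fun _ => id) fun i => .var (.inr i))
    (.app (R.ren Sum.inl fun _ => id) (Term.appVec g fun i => .var (.inr i))))

/-- `𝒫 ⊆ ℛ`, the formula `∀x⃗. 𝒫(x⃗) → ℛ(x⃗)`. -/
def incl {n : ℕ} (P R : Pred S V W n) : Formula S V W :=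
  allVec n (.imp
    (.app (P.ren Sum.inl fun _ => id) fun i => .var (.inr i))
    (.app (R.ren Sum.inl fun _ => id) fun i => .var (.inr i)))

/-- The type `∀X (X ⊆ μ(Φ) → X ⊆_f⃗ 𝒦 → Φ(X) ⊆_{f⃗∘c⃗} 𝒦)` of the step term of primitive
recursion. -/
def recStep {n : ℕ} (c : Fin n → Fn S 1) (Φ : Transformer S n) (f : Fin n → Fn S 1)
    (K : Pred S V W n) : Formula S V W :=
  let X : Pred S V (SVar W n) n := .pvar .new
  let K' : Pred S V (SVar W n) n := K.ren id fun _ => SVar.old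
  .all2 n (.imp (incl X (.mu Φ)) (.imp (inclVia f X K')
    (inclVia (fun i => (f i).comp (c i)) (Φ.apply X) K')))

/-- The type `∀X (ν(Φ) ⊆ X → 𝒦 ⊆_f⃗ X → 𝒦 ⊆_{d⃗∘f⃗} Φ(X))` of the step term of primitive
corecursion. -/
def corecStep {n : ℕ} (d : Fin n → Fn S 1) (Φ : Transformer S n) (f : Fin n → Fn S 1)
    (K : Pred S V W n) : Formula S V W :=
  let X : Pred S V (SVar W n) n := .pvar .new
  let K' : Pred S V (SVar W n) n := K.ren id fun _ => SVar.old
  .all2 n (.imp (incl (.nu Φ) X) (.imp (inclVia f K' X)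
    (inclVia (fun i => (d i).comp (f i)) K' (Φ.apply X))))

end Operations

/-- A comprehension predicate `λx⃗.A` represents `{t⃗ | A[x⃗ := t⃗]}`: formulas are identified along
the congruence generated by `(λx⃗.A)(t⃗) = A[x⃗ := t⃗]`. -/
inductive Conv {S : Signature} :
    {V : Type} → {W : ℕ → Type} → Formula S V W → Formula S V W → Prop
  | beta {V : Type} {W : ℕ → Type} {n : ℕ} (A : Formula S (V ⊕ Fin n) W)
      (t : Fin n → Term S V) : Conv (.app (.compr A) t) (A.instVec t)
  | refl {V : Type} {W : ℕ → Type} (A : Formula S V W) : Conv A A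
  | symm {V : Type} {W : ℕ → Type} {A B : Formula S V W} : Conv A B → Conv B A
  | trans {V : Type} {W : ℕ → Type} {A B C : Formula S V W} : Conv A B → Conv B C → Conv A C
  | imp {V : Type} {W : ℕ → Type} {A A' B B' : Formula S V W} :
      Conv A A' → Conv B B' → Conv (.imp A B) (.imp A' B')
  | all1 {V : Type} {W : ℕ → Type} {A A' : Formula S (Option V) W} :
      Conv A A' → Conv (.all1 A) (.all1 A')
  | all2 {V : Type} {W : ℕ → Type} {m : ℕ} {A A' : Formula S V (SVar W m)} :
      Conv A A' → Conv (.all2 m A) (.all2 m A')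

/-! ## Equational reasoning -/

/-- The defining equations `(f ∘ g)(x) = f(g(x))` of the composed function symbols. -/
def compEqs (S : Signature) : Set (Term S ℕ × Term S ℕ) :=
  {e | ∃ f g : Fn S 1,
    e = (Term.app1 (f.comp g) (.var 0), Term.app1 f (Term.app1 g (.var 0)))}

/-- `EqProv E r s` is `E ▷ r = s`: derivability of `r = s` from the equations in `E`. -/
inductive EqProv {S : Signature} (E : Set (Term S ℕ × Term S ℕ)) {V : Type} :
    Term S V → Term S V → Prop
  | ax {r s : Term S ℕ} (h : (r, s) ∈ E ∪ compEqs S) (τ : ℕ → Term S V) :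
      EqProv E (r.sub τ) (s.sub τ)
  | axSymm {r s : Term S ℕ} (h : (r, s) ∈ E ∪ compEqs S) (τ : ℕ → Term S V) :
      EqProv E (s.sub τ) (r.sub τ)
  | refl (r : Term S V) : EqProv E r r
  | trans {r s t : Term S V} : EqProv E r s → EqProv E s t → EqProv E r t
  | congr {n : ℕ} (f : Fn S n) {r s : Fin n → Term S V} :
      (∀ i, EqProv E (r i) (s i)) → EqProv E (.app f r) (.app f s)

/-! ## Proof-terms and their reduction -/

/-- Proof-terms, with de Bruijn indices:
`x | λx r | r s | in r | out r | MRec s r | MCoRec s r`. -/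
inductive PTerm : Type
  | var : ℕ → PTerm
  | lam : PTerm → PTerm
  | app : PTerm → PTerm → PTerm
  | inn : PTerm → PTerm
  | out : PTerm → PTerm
  | mrec : PTerm → PTerm → PTerm
  | mcorec : PTerm → PTerm → PTerm

namespace PTerm

/-- A renaming under a binder. -/
def liftRen (ρ : ℕ → ℕ) : ℕ → ℕ
  | 0 => 0
  | i + 1 => ρ i + 1

/-- Renaming of free variables. -/
def ren (ρ : ℕ → ℕ) : PTerm → PTerm
  | var i => var (ρ i)
  | lam r => lam (r.ren (liftRen ρ))
  | app r s => app (r.ren ρ) (s.ren ρ)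
  | inn r => inn (r.ren ρ)
  | out r => out (r.ren ρ)
  | mrec s r => mrec (s.ren ρ) (r.ren ρ)
  | mcorec s r => mcorec (s.ren ρ) (r.ren ρ)

/-- A substitution under a binder. -/
def liftSub (σ : ℕ → PTerm) : ℕ → PTerm
  | 0 => var 0
  | i + 1 => (σ i).ren Nat.succ

/-- Simultaneous capture-avoiding substitution. -/
def sub : PTerm → (ℕ → PTerm) → PTerm
  | var i, σ => σ i
  | lam r, σ => lam (r.sub (liftSub σ))
  | app r s, σ => app (r.sub σ) (s.sub σ)
  | inn r, σ => inn (r.sub σ)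
  | out r, σ => out (r.sub σ)
  | mrec s r, σ => mrec (s.sub σ) (r.sub σ)
  | mcorec s r, σ => mcorec (s.sub σ) (r.sub σ)

/-- `r[x := s]`, where `x` is the variable bound in `λx r`. -/
def inst (r s : PTerm) : PTerm :=
  r.sub fun
    | 0 => s
    | i + 1 => var i

/-- `MRec s` without its second argument means `λx. MRec s x`. -/
def mrecFun (s : PTerm) : PTerm := lam (mrec (s.ren Nat.succ) (var 0))

/-- `MCoRec s` without its second argument means `λx. MCoRec s x`. -/
def mcorecFun (s : PTerm) : PTerm := lam (mcorec (s.ren Nat.succ) (var 0))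

/-- One-step reduction `t →_β t'`: the closure of the three axioms under all term formers. -/
inductive Step : PTerm → PTerm → Prop
  | beta (r s : PTerm) : Step (app (lam r) s) (r.inst s)
  | mrecInn (s t : PTerm) :
      Step (mrec s (inn t)) (app (app (app s (lam (var 0))) (mrecFun s)) t)
  | outMcorec (s t : PTerm) :
      Step (out (mcorec s t)) (app (app (app s (lam (var 0))) (mcorecFun s)) t)
  | lam {r r' : PTerm} : Step r r' → Step (lam r) (lam r')
  | appLeft {r r' s : PTerm} : Step r r' → Step (app r s) (app r' s)
  | appRight {r s s' : PTerm} : Step s s' → Step (app r s) (app r s')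
  | inn {r r' : PTerm} : Step r r' → Step (inn r) (inn r')
  | out {r r' : PTerm} : Step r r' → Step (out r) (out r')
  | mrecLeft {s s' r : PTerm} : Step s s' → Step (mrec s r) (mrec s' r)
  | mrecRight {s r r' : PTerm} : Step r r' → Step (mrec s r) (mrec s r')
  | mcorecLeft {s s' r : PTerm} : Step s s' → Step (mcorec s r) (mcorec s' r)
  | mcorecRight {s r r' : PTerm} : Step r r' → Step (mcorec s r) (mcorec s r')

/-- `t` is strongly normalizing: there is no infinite reduction sequence `t → t₁ → t₂ → …`. -/
def StronglyNormalizing (t : PTerm) : Prop :=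
  ¬ ∃ u : ℕ → PTerm, u 0 = t ∧ ∀ i, Step (u i) (u (i + 1))

end PTerm

/-! ## The derivation relation -/

/-- A choice, for every closed `n`-ary predicate transformer `Φ`, of `n` unary function symbols:
the constructors of `μ(Φ)` or the destructors of `ν(Φ)`. -/
abbrev SymbolChoice (S : Signature) : Type 1 := ∀ n : ℕ, Transformer S n → Fin n → Fn S 1

/-- `Derivable con des E Γ t A` is the judgment `Γ ⊢_E t : A`. The variable of index `i` has in the
context `Γ` the `i`-th formula of the list. In `all1I` and `all2I` the quantified variable is new
for `Γ`, which is the usual proviso that it is not free in `Γ`. -/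
inductive Derivable {S : Signature} (con des : SymbolChoice S) (E : Set (Term S ℕ × Term S ℕ)) :
    {V : Type} → {W : ℕ → Type} → List (Formula S V W) → PTerm → Formula S V W → Prop
  | var {V : Type} {W : ℕ → Type} {Γ : List (Formula S V W)} {i : ℕ} {A : Formula S V W} :
      Γ[i]? = some A → Derivable con des E Γ (.var i) A
  | impI {V : Type} {W : ℕ → Type} {Γ : List (Formula S V W)} {r : PTerm}
      {A B : Formula S V W} :
      Derivable con des E (A :: Γ) r B → Derivable con des E Γ (.lam r) (.imp A B)
  | impE {V : Type} {W : ℕ → Type} {Γ : List (Formula S V W)} {r s : PTerm}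
      {A B : Formula S V W} :
      Derivable con des E Γ r (.imp A B) → Derivable con des E Γ s A →
      Derivable con des E Γ (.app r s) B
  | all1I {V : Type} {W : ℕ → Type} {Γ : List (Formula S V W)} {t : PTerm}
      {A : Formula S (Option V) W} :
      Derivable con des E (Γ.map Formula.weaken1) t A → Derivable con des E Γ t (.all1 A)
  | all1E {V : Type} {W : ℕ → Type} {Γ : List (Formula S V W)} {t : PTerm}
      {A : Formula S (Option V) W} (r : Term S V) :
      Derivable con des E Γ t (.all1 A) → Derivable con des E Γ t (A.inst1 r)
  | all2I {V : Type} {W : ℕ → Type} {Γ : List (Formula S V W)} {t : PTerm} {m : ℕ}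
      {A : Formula S V (SVar W m)} :
      Derivable con des E (Γ.map (Formula.weaken2 m)) t A →
      Derivable con des E Γ t (.all2 m A)
  | all2E {V : Type} {W : ℕ → Type} {Γ : List (Formula S V W)} {t : PTerm} {m : ℕ}
      {A : Formula S V (SVar W m)} (P : Pred S V W m) :
      Derivable con des E Γ t (.all2 m A) → Derivable con des E Γ t (A.inst2 P)
  | eq {V : Type} {W : ℕ → Type} {Γ : List (Formula S V W)} {t : PTerm}
      (A : Formula S (Option V) W) {r s : Term S V} :
      Derivable con des E Γ t (A.inst1 r) → EqProv E r s → Derivable con des E Γ t (A.inst1 s)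
  | conv {V : Type} {W : ℕ → Type} {Γ : List (Formula S V W)} {t : PTerm}
      {A B : Formula S V W} :
      Derivable con des E Γ t A → Conv A B → Derivable con des E Γ t B
  | muI {V : Type} {W : ℕ → Type} {Γ : List (Formula S V W)} {r : PTerm} {n : ℕ}
      {Φ : Transformer S n} {t : Fin n → Term S V} :
      Derivable con des E Γ r (.app (Φ.apply (.mu Φ)) t) →
      Derivable con des E Γ (.inn r) (.app (.mu Φ) (Term.appVec (con n Φ) t))
  | muE {V : Type} {W : ℕ → Type} {Γ : List (Formula S V W)} {r s : PTerm} {n : ℕ}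
      {Φ : Transformer S n} {K : Pred S V W n} {f : Fin n → Fn S 1} {t : Fin n → Term S V} :
      Derivable con des E Γ s (recStep (con n Φ) Φ f K) →
      Derivable con des E Γ r (.app (.mu Φ) t) →
      Derivable con des E Γ (.mrec s r) (.app K (Term.appVec f t))
  | nuE {V : Type} {W : ℕ → Type} {Γ : List (Formula S V W)} {r : PTerm} {n : ℕ}
      {Φ : Transformer S n} {t : Fin n → Term S V} :
      Derivable con des E Γ r (.app (.nu Φ) t) →
      Derivable con des E Γ (.out r) (.app (Φ.apply (.nu Φ)) (Term.appVec (des n Φ) t))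
  | nuI {V : Type} {W : ℕ → Type} {Γ : List (Formula S V W)} {r s : PTerm} {n : ℕ}
      {Φ : Transformer S n} {K : Pred S V W n} {f : Fin n → Fn S 1} {t : Fin n → Term S V} :
      Derivable con des E Γ s (corecStep (des n Φ) Φ f K) →
      Derivable con des E Γ r (.app K t) →
      Derivable con des E Γ (.mcorec s r) (.app (.nu Φ) (Term.appVec f t))

end AF2

namespace AF2

namespace PTerm

/-! ## Substitution on proof-terms -/

-- The proof is Girard's reducibility method with the first-order content erased. Objects live in a
-- one-point structure, where every equation holds, so a predicate of any arity denotes a single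
-- candidate, and first-order quantifiers, constructors and destructors leave no trace in the
-- interpretation. Candidates form a complete lattice, which interprets second-order quantifiers by
-- intersection.
--
-- The difficulty is to interpret μ and ν for an operator `φ` on candidates that need not be
-- monotone. Mendler's device replaces `φ` by bounded quantification: `Cand.mu φ` is the least `M`
-- containing `inn r` for every `r ∈ φ X` with `X ≤ M`, and `Cand.nu φ` is the greatest `N` whose
-- elements `t` satisfy `out t ∈ φ X` for every `X ≥ N`. These conditions vary monotonically with
-- the bound whatever `φ` is. They also match the step terms, which are polymorphic in `X`: in the
-- contractum `s (λx x) (MRec s) t` the identity realizes `X ≤ mu φ`, and `MRec s` maps `X` to `K`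
-- once `X` consists of terms on which recursion is known to behave. Hence `Cand.mrec_mem`, and
-- dually `Cand.mcorec_mem`.
--
-- `Derivable.sound` then shows that derivable terms, with realizers substituted, lie in the
-- candidates of their types. Variables lie in every candidate, so the identity substitution gives
-- strong normalization.

theorem liftRen_comp (ρ ρ' : ℕ → ℕ) : liftRen ρ' ∘ liftRen ρ = liftRen (ρ' ∘ ρ) := by
  funext i; cases i <;> rfl

theorem ren_ren (t : PTerm) (ρ ρ' : ℕ → ℕ) : (t.ren ρ).ren ρ' = t.ren (ρ' ∘ ρ) := by
  induction t generalizing ρ ρ' <;> simp_all [ren, liftRen_comp]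

theorem liftSub_comp_liftRen (ρ : ℕ → ℕ) (σ : ℕ → PTerm) :
    liftSub σ ∘ liftRen ρ = liftSub (σ ∘ ρ) := by
  funext i; cases i <;> rfl

theorem sub_ren (t : PTerm) (ρ : ℕ → ℕ) (σ : ℕ → PTerm) : (t.ren ρ).sub σ = t.sub (σ ∘ ρ) := by
  induction t generalizing ρ σ <;> simp_all [ren, sub, liftSub_comp_liftRen]

theorem ren_liftSub (ρ : ℕ → ℕ) (σ : ℕ → PTerm) :
    (fun i => (liftSub σ i).ren (liftRen ρ)) = liftSub fun i => (σ i).ren ρ := by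
  funext i
  cases i with
  | zero => rfl
  | succ i => simp only [liftSub, ren_ren]; rfl

theorem ren_sub (t : PTerm) (σ : ℕ → PTerm) (ρ : ℕ → ℕ) :
    (t.sub σ).ren ρ = t.sub fun i => (σ i).ren ρ := by
  induction t generalizing ρ σ <;> simp_all [ren, sub, ren_liftSub]

theorem sub_liftSub (σ τ : ℕ → PTerm) :
    (fun i => (liftSub σ i).sub (liftSub τ)) = liftSub fun i => (σ i).sub τ := by
  funext i
  cases i with
  | zero => rfl
  | succ i => simp only [liftSub, sub_ren, ren_sub]; rfl

theorem sub_sub (t : PTerm) (σ τ : ℕ → PTerm) :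
    (t.sub σ).sub τ = t.sub fun i => (σ i).sub τ := by
  induction t generalizing σ τ <;> simp_all [sub, sub_liftSub]

theorem liftSub_var : liftSub var = var := by
  funext i; cases i <;> rfl

theorem sub_var (t : PTerm) : t.sub var = t := by
  induction t <;> simp_all [sub, liftSub_var]

/-- The substitution `σ` extended by a value for the variable of index `0`. -/
def consSub (a : PTerm) (σ : ℕ → PTerm) : ℕ → PTerm
  | 0 => a
  | i + 1 => σ i

theorem inst_eq_sub (r s : PTerm) : r.inst s = r.sub (consSub s var) := by
  unfold inst
  congr 1

theorem ren_succ_inst (s a : PTerm) : (s.ren Nat.succ).inst a = s := by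
  rw [inst_eq_sub, sub_ren]
  exact sub_var s

/-- Turns a β-contractum under a substitution back into one simultaneous substitution, the form in
which soundness of `impI` can use its induction hypothesis. -/
theorem sub_liftSub_inst (r a : PTerm) (σ : ℕ → PTerm) :
    (r.sub (liftSub σ)).inst a = r.sub (consSub a σ) := by
  rw [inst_eq_sub, sub_sub]
  congr 1
  funext i
  cases i with
  | zero => rfl
  | succ i => exact (inst_eq_sub _ _).symm.trans (ren_succ_inst (σ i) a)

theorem inst_sub (r s : PTerm) (σ : ℕ → PTerm) :
    (r.inst s).sub σ = (r.sub (liftSub σ)).inst (s.sub σ) := by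
  rw [sub_liftSub_inst, inst_eq_sub, sub_sub]
  congr 1
  funext i; cases i <;> rfl

theorem ren_succ_sub (s : PTerm) (σ : ℕ → PTerm) :
    (s.ren Nat.succ).sub (liftSub σ) = (s.sub σ).ren Nat.succ := by
  rw [sub_ren, ren_sub]; rfl

theorem mrecFun_sub (s : PTerm) (σ : ℕ → PTerm) : s.mrecFun.sub σ = (s.sub σ).mrecFun := by
  simp [mrecFun, sub, ren_succ_sub, liftSub]

theorem mcorecFun_sub (s : PTerm) (σ : ℕ → PTerm) : s.mcorecFun.sub σ = (s.sub σ).mcorecFun := by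
  simp [mcorecFun, sub, ren_succ_sub, liftSub]

theorem Step.sub {t t' : PTerm} (h : Step t t') (σ : ℕ → PTerm) :
    Step (t.sub σ) (t'.sub σ) := by
  induction h generalizing σ with
  | beta r s => rw [inst_sub]; exact .beta _ _
  | mrecInn s t => simp only [PTerm.sub, mrecFun_sub]; exact .mrecInn _ _
  | outMcorec s t => simp only [PTerm.sub, mcorecFun_sub]; exact .outMcorec _ _
  | lam _ ih => exact .lam (ih _)
  | appLeft _ ih => exact .appLeft (ih _)
  | appRight _ ih => exact .appRight (ih _)
  | inn _ ih => exact .inn (ih _)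
  | out _ ih => exact .out (ih _)
  | mrecLeft _ ih => exact .mrecLeft (ih _)
  | mrecRight _ ih => exact .mrecRight (ih _)
  | mcorecLeft _ ih => exact .mcorecLeft (ih _)
  | mcorecRight _ ih => exact .mcorecRight (ih _)

theorem Step.inst {r r' : PTerm} (h : Step r r') (s : PTerm) : Step (r.inst s) (r'.inst s) :=
  h.sub _

/-! ## Strong normalization as accessibility -/

/-- Accessibility for reduction. -/
def SN (t : PTerm) : Prop := Acc (fun a b => Step b a) t

theorem SN.step {t t' : PTerm} (h : SN t) (hs : Step t t') : SN t' := h.inv hs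

/-- Reductions of `t` are simulated one for one inside `f t`. Used to extract normalization of a
function from an application, and of a body from an instance. -/
theorem SN.of_map {f : PTerm → PTerm} (hf : ∀ {a b}, Step a b → Step (f a) (f b)) {t : PTerm}
    (h : SN (f t)) : SN t := by
  generalize hu : f t = u at h
  induction h generalizing t with
  | intro u _ ih =>
    subst hu
    exact ⟨_, fun t' ht' => ih _ (hf ht') rfl⟩

theorem SN.stronglyNormalizing {t : PTerm} (h : SN t) : t.StronglyNormalizing := by
  induction h with
  | intro t _ ih =>
    rintro ⟨u, rfl, hu⟩
    exact ih (u 1) (hu 0) ⟨fun i => u (i + 1), rfl, fun i => hu (i + 1)⟩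

theorem SN.lam {r : PTerm} (h : SN r) : SN (.lam r) := by
  induction h with
  | intro r _ ih =>
    refine ⟨_, fun t ht => ?_⟩
    cases ht with
    | lam h => exact ih _ h

theorem SN.inn {r : PTerm} (h : SN r) : SN (.inn r) := by
  induction h with
  | intro r _ ih =>
    refine ⟨_, fun t ht => ?_⟩
    cases ht with
    | inn h => exact ih _ h

/-- `MCoRec s r` is a redex only under `out`, so its own reductions all take place inside `s` or
`r`. -/
theorem SN.mcorec {s r : PTerm} (hs : SN s) (hr : SN r) : SN (.mcorec s r) := by
  induction hs generalizing r with
  | intro s _ ihs =>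
    induction hr with
    | intro r hr ihr =>
      refine ⟨_, fun t ht => ?_⟩
      cases ht with
      | mcorecLeft h => exact ihs _ h ⟨_, hr⟩
      | mcorecRight h => exact ihr _ h

/-- Terms that are not introductions: they create no redex when an elimination is applied. -/
def Neutral : PTerm → Prop
  | lam _ => False
  | inn _ => False
  | mcorec _ _ => False
  | _ => True

end PTerm

open PTerm

/-! ## Reducibility candidates -/

/-- Girard's reducibility candidates. -/
@[ext]
structure Cand where
  carrier : Set PTerm
  sn : ∀ {t}, t ∈ carrier → SN t
  step : ∀ {t t'}, t ∈ carrier → Step t t' → t' ∈ carrier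
  neutral : ∀ {t}, Neutral t → (∀ t', Step t t' → t' ∈ carrier) → t ∈ carrier

namespace Cand

instance : Membership PTerm Cand := ⟨fun C t => t ∈ C.carrier⟩

instance : PartialOrder Cand where
  le C D := ∀ t, t ∈ C → t ∈ D
  le_refl _ _ h := h
  le_trans _ _ _ h h' t ht := h' t (h t ht)
  le_antisymm _ _ h h' := Cand.ext (Set.ext fun t => ⟨h t, h' t⟩)

instance : InfSet Cand where
  sInf 𝒞 :=
    { carrier := {t | SN t ∧ ∀ C ∈ 𝒞, t ∈ C}
      -- The explicit conjunct `SN t` matters only for the empty family, whose infimum is then the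
      -- set of all strongly normalizing terms.
      sn := fun h => h.1
      step := fun h hs => ⟨h.1.step hs, fun C hC => C.step (h.2 C hC) hs⟩
      neutral := fun hn h =>
        ⟨⟨_, fun t' ht' => (h t' ht').1⟩, fun C hC => C.neutral hn fun t' ht' => (h t' ht').2 C hC⟩ }

theorem mem_sInf {𝒞 : Set Cand} {t : PTerm} : t ∈ sInf 𝒞 ↔ SN t ∧ ∀ C ∈ 𝒞, t ∈ C := Iff.rfl

instance : CompleteLattice Cand :=
  completeLatticeOfInf Cand fun _ =>
    ⟨fun C hC _ ht => ht.2 C hC, fun D hD t ht => ⟨D.sn ht, fun _ hC => hD hC t ht⟩⟩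

theorem var_mem (C : Cand) (i : ℕ) : PTerm.var i ∈ C :=
  C.neutral trivial fun _ h => nomatch h

/-- The candidate of an implication. -/
def arrow (A B : Cand) : Cand where
  carrier := {t | ∀ a ∈ A, PTerm.app t a ∈ B}
  sn h := SN.of_map (f := fun t => .app t (.var 0)) .appLeft (B.sn (h _ (A.var_mem 0)))
  step h hs a ha := B.step (h a ha) (.appLeft hs)
  neutral {t} hn h a ha := by
    -- Since `t` is not an abstraction, `t a` has no root redex; induction on the reductions of `a`
    -- handles the rest.
    induction A.sn ha with
    | intro a _ ih =>
      refine B.neutral trivial fun u hu => ?_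
      cases hu with
      | beta => exact hn.elim
      | appLeft hs => exact h _ hs a ha
      | appRight hs => exact ih _ hs (A.step ha hs)

theorem app_mem {A B : Cand} {t a : PTerm} (ht : t ∈ arrow A B) (ha : a ∈ A) :
    PTerm.app t a ∈ B := ht a ha

/-- `λr` applied to `a` is neutral, so it suffices to treat its reducts, by nested induction on
normalization of `r` and of `a`; the root contraction is the hypothesis. -/
theorem lam_mem {A B : Cand} {r : PTerm} (h : ∀ a ∈ A, r.inst a ∈ B) :
    PTerm.lam r ∈ arrow A B := by
  intro a ha
  have hr : SN r := SN.of_map (f := fun t => t.inst (.var 0)) (fun h => h.inst _)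
    (B.sn (h _ (A.var_mem 0)))
  induction hr generalizing a with
  | intro r _ ihr =>
    induction A.sn ha with
    | intro a _ iha =>
      refine B.neutral trivial fun u hu => ?_
      cases hu with
      | beta => exact h a ha
      | appLeft hs =>
        cases hs with
        | lam hs => exact ihr _ hs (fun b hb => B.step (h b hb) (hs.inst b)) a ha
      | appRight hs => exact iha _ hs (A.step ha hs)

/-- The order on candidates is realized by the identity term; this is what the argument `λx x` in
the two recursion axioms supplies. -/
theorem id_mem {A B : Cand} (h : A ≤ B) : PTerm.lam (.var 0) ∈ arrow A B :=
  lam_mem h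

theorem mrecFun_mem {A B : Cand} {s : PTerm} (h : ∀ a ∈ A, PTerm.mrec s a ∈ B) :
    s.mrecFun ∈ arrow A B := by
  refine lam_mem fun a ha => ?_
  have : (PTerm.mrec (s.ren Nat.succ) (.var 0)).inst a = .mrec s a :=
    congrArg (PTerm.mrec · a) (ren_succ_inst s a)
  rw [this]
  exact h a ha

theorem mcorecFun_mem {A B : Cand} {s : PTerm} (h : ∀ a ∈ A, PTerm.mcorec s a ∈ B) :
    s.mcorecFun ∈ arrow A B := by
  refine lam_mem fun a ha => ?_
  have : (PTerm.mcorec (s.ren Nat.succ) (.var 0)).inst a = .mcorec s a :=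
    congrArg (PTerm.mcorec · a) (ren_succ_inst s a)
  rw [this]
  exact h a ha

/-- The intersection of a family of candidates. -/
def all (F : Cand → Cand) : Cand := sInf (Set.range F)

theorem mem_all {F : Cand → Cand} {t : PTerm} : t ∈ all F ↔ ∀ C, t ∈ F C :=
  ⟨fun h C => h.2 _ ⟨C, rfl⟩, fun h => ⟨(F ⊤).sn (h ⊤), by rintro _ ⟨C, rfl⟩; exact h C⟩⟩

/-! ### Least fixed points of arbitrary operators -/

/-- The least candidate closed under `inn r` for all `r ∈ φ X` with `X` below it. -/
def mu (φ : Cand → Cand) : Cand :=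
  sInf {M | ∀ X ≤ M, ∀ r ∈ φ X, PTerm.inn r ∈ M}

/-- The closure condition passes to the intersection because a bound `X ≤ mu φ` is also a bound
below every closed `M`; monotonicity of `φ` is not needed. -/
theorem inn_mem_mu {φ : Cand → Cand} {X : Cand} (hX : X ≤ mu φ) {r : PTerm} (hr : r ∈ φ X) :
    PTerm.inn r ∈ mu φ :=
  ⟨((φ X).sn hr).inn, fun _ hM => hM X (hX.trans (sInf_le hM)) r hr⟩

/-- The step terms of recursion on `mu φ` with values in `K`. -/
def recStep (φ : Cand → Cand) (K : Cand) : Cand :=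
  all fun X => arrow (arrow X (mu φ)) (arrow (arrow X K) (arrow (φ X) K))

/-- The terms on which recursion with any step term has its value in `K`. -/
def recDomain (φ : Cand → Cand) (K : Cand) : Cand where
  carrier := {r | r ∈ mu φ ∧ ∀ s ∈ recStep φ K, PTerm.mrec s r ∈ K}
  sn h := (mu φ).sn h.1
  step h hs := ⟨(mu φ).step h.1 hs, fun s hs' => K.step (h.2 s hs') (.mrecRight hs)⟩
  neutral {r} hn h := by
    refine ⟨(mu φ).neutral hn fun t' ht' => (h t' ht').1, fun s hs => ?_⟩
    -- Reducts of `s` must be admitted too, which is why `recDomain` quantifies over all step terms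
    -- instead of fixing one.
    induction (recStep φ K).sn hs with
    | intro s _ ih =>
      refine K.neutral trivial fun u hu => ?_
      cases hu with
      | mrecInn => exact hn.elim
      | mrecLeft h' => exact ih _ h' ((recStep φ K).step hs h')
      | mrecRight h' => exact (h _ h').2 s hs

/-- The polymorphic step term is used at `X` itself: both halves of `X ≤ recDomain φ K` are
consumed, membership in `mu φ` for the identity argument and values in `K` for the recursive call.
-/
theorem mrec_inn_mem {φ : Cand → Cand} {K X : Cand} (hX : X ≤ recDomain φ K) {s r : PTerm}
    (hs : s ∈ recStep φ K) (hr : r ∈ φ X) : PTerm.mrec s (.inn r) ∈ K := by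
  have hsn := (recStep φ K).sn hs
  induction hsn generalizing r with
  | intro s _ ihs =>
    have hrn := (φ X).sn hr
    induction hrn with
    | intro r _ ihr =>
      refine K.neutral trivial fun u hu => ?_
      cases hu with
      | mrecInn =>
        exact app_mem (app_mem (app_mem (mem_all.1 hs X) (id_mem fun t ht => (hX t ht).1))
          (mrecFun_mem fun a ha => (hX a ha).2 s hs)) hr
      | mrecLeft h => exact ihs _ h ((recStep φ K).step hs h) hr
      | mrecRight h =>
        cases h with
        | inn h => exact ihr _ h ((φ X).step hr h)

/-- `recDomain φ K` satisfies the closure condition defining `mu φ`, so leastness puts all of `mu φ`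
inside it. -/
theorem mrec_mem {φ : Cand → Cand} {K : Cand} {s r : PTerm} (hs : s ∈ recStep φ K)
    (hr : r ∈ mu φ) : PTerm.mrec s r ∈ K :=
  (hr.2 (recDomain φ K) fun _ hX _ hr' =>
    ⟨inn_mem_mu (fun t ht => (hX t ht).1) hr', fun _ hs' => mrec_inn_mem hX hs' hr'⟩).2 s hs

/-! ### Greatest fixed points of arbitrary operators -/

/-- The terms `t` with `out t ∈ φ X` for every `X` above `N`. -/
def outPreimage (φ : Cand → Cand) (N : Cand) : Cand where
  carrier := {t | SN t ∧ ∀ X, N ≤ X → PTerm.out t ∈ φ X}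
  sn h := h.1
  step h hs := ⟨h.1.step hs, fun X hX => (φ X).step (h.2 X hX) (.out hs)⟩
  neutral {t} hn h := by
    refine ⟨⟨_, fun t' ht' => (h t' ht').1⟩, fun X hX => (φ X).neutral trivial fun u hu => ?_⟩
    cases hu with
    | outMcorec => exact hn.elim
    | out h' => exact (h _ h').2 X hX

/-- `outPreimage φ` as a monotone map. -/
def outPreimageHom (φ : Cand → Cand) : Cand →o Cand where
  toFun := outPreimage φ
  -- Enlarging the bound leaves fewer `X` above it, hence fewer conditions on `t`.
  monotone' _ _ h _ ht := ⟨ht.1, fun X hX => ht.2 X (h.trans hX)⟩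

/-- The greatest candidate `N` such that `out t ∈ φ X` for all `t ∈ N` and all `X` above `N`. -/
def nu (φ : Cand → Cand) : Cand := (outPreimageHom φ).gfp

theorem nu_le_outPreimage (φ : Cand → Cand) : nu φ ≤ outPreimage φ (nu φ) :=
  (outPreimageHom φ).map_gfp.ge

theorem out_mem {φ : Cand → Cand} {t : PTerm} (ht : t ∈ nu φ) : PTerm.out t ∈ φ (nu φ) :=
  (nu_le_outPreimage φ t ht).2 _ le_rfl

/-- The step terms of corecursion into `nu φ` from `K`. -/
def corecStep (φ : Cand → Cand) (K : Cand) : Cand :=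
  all fun X => arrow (arrow (nu φ) X) (arrow (arrow K X) (arrow K (φ X)))

/-- The least candidate above `nu φ` that contains all corecursive terms with seed in `K`. -/
def corecRange (φ : Cand → Cand) (K : Cand) : Cand :=
  sInf {N | nu φ ≤ N ∧ ∀ s ∈ corecStep φ K, ∀ r ∈ K, PTerm.mcorec s r ∈ N}

theorem nu_le_corecRange (φ : Cand → Cand) (K : Cand) : nu φ ≤ corecRange φ K :=
  le_sInf fun _ hN => hN.1

theorem mcorec_mem_corecRange {φ : Cand → Cand} {K : Cand} {s r : PTerm}
    (hs : s ∈ corecStep φ K) (hr : r ∈ K) : PTerm.mcorec s r ∈ corecRange φ K :=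
  ⟨((corecStep φ K).sn hs).mcorec (K.sn hr), fun _ hN => hN.2 s hs r hr⟩

/-- Dual to `mrec_inn_mem`: as `X` lies above `corecRange φ K`, it contains `nu φ`, which types the
identity, and all corecursive terms, which types the corecursive call. -/
theorem out_mcorec_mem {φ : Cand → Cand} {K X : Cand} (hX : corecRange φ K ≤ X) {s r : PTerm}
    (hs : s ∈ corecStep φ K) (hr : r ∈ K) : PTerm.out (.mcorec s r) ∈ φ X := by
  have hsn := (corecStep φ K).sn hs
  induction hsn generalizing r with
  | intro s _ ihs =>
    have hrn := K.sn hr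
    induction hrn with
    | intro r _ ihr =>
      refine (φ X).neutral trivial fun u hu => ?_
      cases hu with
      | outMcorec =>
        exact app_mem (app_mem (app_mem (mem_all.1 hs X)
          (id_mem ((nu_le_corecRange φ K).trans hX)))
          (mcorecFun_mem fun a ha => hX _ (mcorec_mem_corecRange hs ha))) hr
      | out h =>
        cases h with
        | mcorecLeft h => exact ihs _ h ((corecStep φ K).step hs h) hr
        | mcorecRight h => exact ihr _ h (K.step hr h)

/-- Coinduction: `corecRange φ K` is a post-fixed point of `outPreimage φ`, hence below the greatest
one. To see this, `outPreimage φ (corecRange φ K)` is shown to be a member of the family whose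
infimum is `corecRange φ K`. -/
theorem mcorec_mem {φ : Cand → Cand} {K : Cand} {s r : PTerm} (hs : s ∈ corecStep φ K)
    (hr : r ∈ K) : PTerm.mcorec s r ∈ nu φ := by
  have h : corecRange φ K ≤ outPreimage φ (corecRange φ K) :=
    sInf_le ⟨(nu_le_outPreimage φ).trans ((outPreimageHom φ).monotone (nu_le_corecRange φ K)),
      fun s hs r hr => ⟨((corecStep φ K).sn hs).mcorec (K.sn hr),
        fun _ hX => out_mcorec_mem hX hs hr⟩⟩
  exact (outPreimageHom φ).le_gfp h _ (mcorec_mem_corecRange hs hr)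

end Cand

/-! ## Interpretation of formulas

First-order objects live in the one-element structure, which satisfies every equation; a predicate
is therefore interpreted by a single candidate. -/

/-- An assignment of candidates to second-order variables, extended to a new variable. -/
def extend {W : ℕ → Type} {m : ℕ} (C : Cand) (η : ∀ k, W k → Cand) : ∀ k, SVar W m k → Cand
  | _, .new => C
  | k, .old X => η k X

mutual
  /-- The candidate of a predicate. -/
  def Pred.interp {S : Signature} : {V : Type} → {W : ℕ → Type} → {n : ℕ} → Pred S V W n →
      (∀ k, W k → Cand) → Cand
    | _, _, _, .pvar X, η => η _ X
    -- No rule concerns predicate symbols specifically, so any fixed candidate would serve.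
    | _, _, _, .rel _, _ => ⊤
    | _, _, _, .compr A, η => A.interp η
    | _, _, _, .mu Φ, _ => Cand.mu fun C => Φ.interp (extend C fun _ X => X.elim)
    | _, _, _, .nu Φ, _ => Cand.nu fun C => Φ.interp (extend C fun _ X => X.elim)

  /-- The candidate of a formula. -/
  def Formula.interp {S : Signature} : {V : Type} → {W : ℕ → Type} → Formula S V W →
      (∀ k, W k → Cand) → Cand
    | _, _, .app P _, η => P.interp η
    | _, _, .imp A B, η => Cand.arrow (A.interp η) (B.interp η)
    | _, _, .all1 A, η => A.interp η
    | _, _, .all2 _ A, η => Cand.all fun C => A.interp (extend C η)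
end

-- Renaming and substitution under the interpretation

theorem extend_lift {W W' : ℕ → Type} {m : ℕ} (θ : ∀ k, W k → W' k) (C : Cand)
    (η : ∀ k, W' k → Cand) :
    (fun k X => extend C η k (SVar.lift (m := m) θ k X)) = extend C fun k X => η k (θ k X) := by
  funext k X; cases X <;> rfl

mutual
  theorem Pred.interp_ren {S : Signature} : ∀ {V : Type} {W : ℕ → Type} {n : ℕ}
      (P : Pred S V W n) {V' : Type} {W' : ℕ → Type} (ρ : V → V') (θ : ∀ k, W k → W' k)
      (η : ∀ k, W' k → Cand), (P.ren ρ θ).interp η = P.interp fun k X => η k (θ k X)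
    | _, _, _, .pvar X, _, _, _, _, _ => by simp only [Pred.ren, Pred.interp]
    | _, _, _, .rel _, _, _, _, _, _ => by simp only [Pred.ren, Pred.interp]
    | _, _, _, .compr A, _, _, ρ, θ, η => by
        simp only [Pred.ren, Pred.interp]; exact A.interp_ren _ θ η
    | _, _, _, .mu _, _, _, _, _, _ => by simp only [Pred.ren, Pred.interp]
    | _, _, _, .nu _, _, _, _, _, _ => by simp only [Pred.ren, Pred.interp]

  theorem Formula.interp_ren {S : Signature} : ∀ {V : Type} {W : ℕ → Type}
      (A : Formula S V W) {V' : Type} {W' : ℕ → Type} (ρ : V → V') (θ : ∀ k, W k → W' k)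
      (η : ∀ k, W' k → Cand), (A.ren ρ θ).interp η = A.interp fun k X => η k (θ k X)
    | _, _, .app P _, _, _, ρ, θ, η => by
        simp only [Formula.ren, Formula.interp]; exact P.interp_ren ρ θ η
    | _, _, .imp A B, _, _, ρ, θ, η => by
        simp only [Formula.ren, Formula.interp]; rw [A.interp_ren ρ θ η, B.interp_ren ρ θ η]
    | _, _, .all1 A, _, _, ρ, θ, η => by
        simp only [Formula.ren, Formula.interp]; exact A.interp_ren _ θ η
    | _, _, .all2 _ A, _, _, ρ, θ, η => by
        simp only [Formula.ren, Formula.interp]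
        congr 1
        funext C
        rw [A.interp_ren ρ _ _, extend_lift]
end

theorem interp_liftSVar {S : Signature} {V' : Type} {W W' : ℕ → Type} {m : ℕ}
    (τ : ∀ k, W k → Pred S V' W' k) (C : Cand) (η : ∀ k, W' k → Cand) :
    (fun k X => (liftSVar (m := m) τ k X).interp (extend C η)) =
      extend C fun k X => (τ k X).interp η := by
  funext k X
  cases X with
  | new => simp only [liftSVar, Pred.interp]; rfl
  | old X => simp only [liftSVar, Pred.interp_ren]; rfl

mutual
  theorem Pred.interp_sub {S : Signature} : ∀ {V : Type} {W : ℕ → Type} {n : ℕ}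
      (P : Pred S V W n) {V' : Type} {W' : ℕ → Type} (σ : V → Term S V')
      (τ : ∀ k, W k → Pred S V' W' k) (η : ∀ k, W' k → Cand),
      (P.sub σ τ).interp η = P.interp fun k X => (τ k X).interp η
    | _, _, _, .pvar X, _, _, _, _, _ => by simp only [Pred.sub, Pred.interp]
    | _, _, _, .rel _, _, _, _, _, _ => by simp only [Pred.sub, Pred.interp]
    | _, _, _, .compr A, _, _, σ, τ, η => by
        simp only [Pred.sub, Pred.interp]
        rw [A.interp_sub _ _ η]
        simp only [Pred.interp_ren, id]
    | _, _, _, .mu _, _, _, _, _, _ => by simp only [Pred.sub, Pred.interp]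
    | _, _, _, .nu _, _, _, _, _, _ => by simp only [Pred.sub, Pred.interp]

  theorem Formula.interp_sub {S : Signature} : ∀ {V : Type} {W : ℕ → Type}
      (A : Formula S V W) {V' : Type} {W' : ℕ → Type} (σ : V → Term S V')
      (τ : ∀ k, W k → Pred S V' W' k) (η : ∀ k, W' k → Cand),
      (A.sub σ τ).interp η = A.interp fun k X => (τ k X).interp η
    | _, _, .app P _, _, _, σ, τ, η => by
        simp only [Formula.sub, Formula.interp]; exact P.interp_sub σ τ η
    | _, _, .imp A B, _, _, σ, τ, η => by
        simp only [Formula.sub, Formula.interp]; rw [A.interp_sub σ τ η, B.interp_sub σ τ η]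
    | _, _, .all1 A, _, _, σ, τ, η => by
        simp only [Formula.sub, Formula.interp]
        rw [A.interp_sub _ _ η]
        simp only [Pred.interp_ren, id]
    | _, _, .all2 _ A, _, _, σ, τ, η => by
        simp only [Formula.sub, Formula.interp]
        congr 1
        funext C
        rw [A.interp_sub σ _ _, interp_liftSVar]
end

-- Interpretation of instances, inclusions and step types

section Interp

variable {S : Signature} {V : Type} {W : ℕ → Type}

theorem Formula.interp_inst1 (A : Formula S (Option V) W) (r : Term S V)
    (η : ∀ k, W k → Cand) : (A.inst1 r).interp η = A.interp η := by
  simp only [Formula.inst1, Formula.interp_sub, Pred.interp]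

theorem Formula.interp_instVec {n : ℕ} (A : Formula S (V ⊕ Fin n) W) (t : Fin n → Term S V)
    (η : ∀ k, W k → Cand) : (A.instVec t).interp η = A.interp η := by
  simp only [Formula.instVec, Formula.interp_sub, Pred.interp]

theorem Formula.interp_inst2 {m : ℕ} (A : Formula S V (SVar W m)) (P : Pred S V W m)
    (η : ∀ k, W k → Cand) : (A.inst2 P).interp η = A.interp (extend (P.interp η) η) := by
  rw [Formula.inst2, Formula.interp_sub]
  congr 1
  funext k X
  cases X with
  | new => rfl
  | old X => simp only [instSVar, Pred.interp]; rfl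

theorem Formula.interp_weaken1 (A : Formula S V W) (η : ∀ k, W k → Cand) :
    A.weaken1.interp η = A.interp η :=
  A.interp_ren _ _ η

theorem Formula.interp_weaken2 {m : ℕ} (A : Formula S V W) (C : Cand) (η : ∀ k, W k → Cand) :
    (A.weaken2 m).interp (extend C η) = A.interp η :=
  A.interp_ren _ _ _

theorem Transformer.interp_apply {n : ℕ} (Φ : Transformer S n) (R : Pred S V W n)
    (η : ∀ k, W k → Cand) :
    (Φ.apply R).interp η = Pred.interp Φ (extend (R.interp η) fun _ X => X.elim) := by
  rw [Transformer.apply, Pred.interp_sub]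
  congr 1
  funext k X
  cases X with
  | new => rfl
  | old X => exact X.elim

theorem interp_allVec : ∀ (n : ℕ) (A : Formula S (V ⊕ Fin n) W) (η : ∀ k, W k → Cand),
    (allVec n A).interp η = A.interp η
  | 0, A, η => A.interp_ren _ _ η
  | n + 1, A, η => by
      rw [allVec, interp_allVec n]
      simp only [Formula.interp]
      exact A.interp_ren _ _ η

theorem interp_incl {n : ℕ} (P R : Pred S V W n) (η : ∀ k, W k → Cand) :
    (incl P R).interp η = Cand.arrow (P.interp η) (R.interp η) := by
  simp only [incl, interp_allVec, Formula.interp, Pred.interp_ren, id]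

theorem interp_inclVia {n : ℕ} (g : Fin n → Fn S 1) (P R : Pred S V W n)
    (η : ∀ k, W k → Cand) :
    (inclVia g P R).interp η = Cand.arrow (P.interp η) (R.interp η) := by
  simp only [inclVia, interp_allVec, Formula.interp, Pred.interp_ren, id]

/-- With inclusions read as arrows and function vectors erased, the syntactic step type becomes
exactly the candidate for which `Cand.mrec_mem` was proved. -/
theorem interp_recStep {n : ℕ} (c : Fin n → Fn S 1) (Φ : Transformer S n) (f : Fin n → Fn S 1)
    (K : Pred S V W n) (η : ∀ k, W k → Cand) :
    (recStep c Φ f K).interp η =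
      Cand.recStep (fun C => Pred.interp Φ (extend C fun _ X => X.elim)) (K.interp η) := by
  simp only [recStep, Formula.interp, interp_incl, interp_inclVia, Pred.interp, Pred.interp_ren,
    Transformer.interp_apply]
  rfl

theorem interp_corecStep {n : ℕ} (d : Fin n → Fn S 1) (Φ : Transformer S n)
    (f : Fin n → Fn S 1) (K : Pred S V W n) (η : ∀ k, W k → Cand) :
    (corecStep d Φ f K).interp η =
      Cand.corecStep (fun C => Pred.interp Φ (extend C fun _ X => X.elim)) (K.interp η) := by
  simp only [corecStep, Formula.interp, interp_incl, interp_inclVia, Pred.interp,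
    Pred.interp_ren, Transformer.interp_apply]
  rfl

end Interp

theorem Conv.interp_eq {S : Signature} {V : Type} {W : ℕ → Type} {A B : Formula S V W}
    (h : Conv A B) : ∀ η, A.interp η = B.interp η := by
  induction h with
  | beta A t => intro η; simp only [Formula.interp_instVec, Formula.interp, Pred.interp]
  | refl => exact fun _ => rfl
  | symm _ ih => exact fun η => (ih η).symm
  | trans _ _ ih ih' => exact fun η => (ih η).trans (ih' η)
  | imp _ _ ih ih' => intro η; simp only [Formula.interp, ih, ih']
  | all1 _ ih => intro η; simp only [Formula.interp, ih]
  | all2 _ ih => intro η; simp only [Formula.interp, ih]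

/-! ## Soundness -/

/-- A derivable judgment is realized under every assignment and every substitution of realizers
of the context. -/
theorem Derivable.sound {S : Signature} {con des : SymbolChoice S}
    {E : Set (Term S ℕ × Term S ℕ)} {V : Type} {W : ℕ → Type} {Γ : List (Formula S V W)}
    {t : PTerm} {A : Formula S V W} (h : Derivable con des E Γ t A) :
    ∀ (η : ∀ k, W k → Cand) (σ : ℕ → PTerm),
      (∀ (i : ℕ) (B : Formula S V W), Γ[i]? = some B → σ i ∈ B.interp η) →
      t.sub σ ∈ A.interp η := by
  induction h with
  | var h => exact fun η σ hσ => hσ _ _ h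
  | impI _ ih =>
    intro η σ hσ
    simp only [Formula.interp, PTerm.sub]
    refine Cand.lam_mem fun a ha => ?_
    rw [sub_liftSub_inst]
    refine ih η _ fun i B hB => ?_
    cases i with
    | zero =>
      obtain rfl := Option.some.inj hB
      exact ha
    | succ i => exact hσ i B hB
  | impE _ _ ih ih' =>
    intro η σ hσ
    have h := ih η σ hσ
    simp only [Formula.interp] at h
    exact Cand.app_mem h (ih' η σ hσ)
  | all1I _ ih =>
    intro η σ hσ
    simp only [Formula.interp]
    refine ih η σ fun i B hB => ?_
    obtain ⟨C, hC, rfl⟩ : ∃ C, _ ∧ Formula.weaken1 C = B := by simpa using hB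
    rw [Formula.interp_weaken1]
    exact hσ i C hC
  | all1E r _ ih =>
    intro η σ hσ
    have h := ih η σ hσ
    simp only [Formula.interp] at h
    rwa [Formula.interp_inst1]
  | all2I _ ih =>
    intro η σ hσ
    simp only [Formula.interp]
    refine Cand.mem_all.2 fun D => ih _ σ fun i B hB => ?_
    obtain ⟨C, hC, rfl⟩ : ∃ C, _ ∧ Formula.weaken2 _ C = B := by simpa using hB
    rw [Formula.interp_weaken2]
    exact hσ i C hC
  | all2E P _ ih =>
    intro η σ hσ
    have h := ih η σ hσ
    simp only [Formula.interp] at h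
    rw [Formula.interp_inst2]
    exact Cand.mem_all.1 h _
  | eq A _ _ ih =>
    intro η σ hσ
    have h := ih η σ hσ
    -- Both instances have the candidate of `A` itself, so the equation proved between the two terms
    -- plays no role.
    rwa [Formula.interp_inst1] at h ⊢
  | conv _ hc ih => exact fun η σ hσ => hc.interp_eq η ▸ ih η σ hσ
  | muI _ ih =>
    intro η σ hσ
    have h := ih η σ hσ
    simp only [Formula.interp, Transformer.interp_apply, Pred.interp] at h ⊢
    exact Cand.inn_mem_mu le_rfl h
  | muE _ _ ih ih' =>
    intro η σ hσ
    have h := ih η σ hσ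
    have h' := ih' η σ hσ
    rw [interp_recStep] at h
    simp only [Formula.interp, Pred.interp] at h' ⊢
    exact Cand.mrec_mem h h'
  | nuE _ ih =>
    intro η σ hσ
    have h := ih η σ hσ
    simp only [Formula.interp, Transformer.interp_apply, Pred.interp] at h ⊢
    exact Cand.out_mem h
  | nuI _ _ ih ih' =>
    intro η σ hσ
    have h := ih η σ hσ
    have h' := ih' η σ hσ
    rw [interp_corecStep] at h
    simp only [Formula.interp, Pred.interp] at h' ⊢
    exact Cand.mcorec_mem h h'

end AF2

theorem mainTheorem1 (S : AF2.Signature) (con des : AF2.SymbolChoice S)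
    (E : Set (AF2.Term S ℕ × AF2.Term S ℕ)) (V : Type) (W : ℕ → Type)
    (Γ : List (AF2.Formula S V W)) (t : AF2.PTerm) (A : AF2.Formula S V W)
    (h : AF2.Derivable con des E Γ t A) : t.StronglyNormalizing := by
  -- The assignment is arbitrary; variables realize every formula of the context, so the identity
  -- substitution is admissible.
  have ht := h.sound (fun _ _ => ⊤) AF2.PTerm.var fun i B _ => AF2.Cand.var_mem _ i
  rw [AF2.PTerm.sub_var] at ht
  exact ((A.interp fun _ _ => ⊤).sn ht).stronglyNormalizing
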